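/- Let $R$ be a commutative Noetherian Cohen--Macaulay ring of Krull dimension $1$ (not necessarily local) which is generically Gorenstein, i.e. $R_{\mathfrak p}$ is a Gorenstein local ring for every associated prime $\mathfrak p$ of $R$. Let $Q(R)$ be the total ring of fractions of $R$, and let $R\subseteq S\subseteq Q(R)$ be a ring extension such that $S$ is a finitely generated $R$-module. All modules are finitely generated. For $A\in\{R,S\}$ let $\operatorname{refl}(A)$ be the class of reflexive $A$-modules (those for which the canonical map $M\to M^{**}$ is an isomorphism), let $\operatorname{CM}(A)$ be the class of maximal Cohen--Macaulay $A$-modules (those $N$ such that, for every maximal ideal $\mathfrak m$ of $A$, $N_{\mathfrak m}=0$ or $\operatorname{depth}_{A_{\mathfrak m}} N_{\mathfrak m}=\dim A_{\mathfrak m}$), and let $\Omega\operatorname{CM}(A)$ be the class of $A$-modules $M$ for which there is an exact sequence $0\to M\to P\to N\to 0$ of $A$-modules with $P$ projective and $N\in\operatorname{CM}(A)$. Let $\operatorname{tr}_R(M)=\sum_{f\in\operatorname{Hom}_R(M,R)}f(M)$ be the trace ideal of an $R$-module $M$ and let $\mathfrak c_R(S)=\{a\in Q(R): aS\subseteq R\}$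 be the conductor. Regard $S$-modules as $R$-modules by restriction of scalars. Then the following are equivalent: \begin{enumerate} \item $S\in\operatorname{refl}(R)$; \item $\Omega\operatorname{CM}(S)\subseteq\Omega\operatorname{CM}(R)$; \item $\operatorname{refl}(S)\subseteq\operatorname{refl}(R)$; \item $\operatorname{refl}(S)\subseteq\{M\in\operatorname{refl}(R):\operatorname{tr}_R(M)\subseteq\mathfrak c_R(S)\}$. \end{enumerate} -/

import Mathlib

universe u

namespace BirationalExt

/-- The depth of a module `M` over a local ring `A`: the supremum of the lengths of the
`M`-regular sequences contained in the maximal ideal. -/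
noncomputable def localDepth (A : Type u) [CommRing A] [IsLocalRing A]
    (M : Type u) [AddCommGroup M] [Module A M] : ℕ∞ :=
  ⨆ (rs : List A) (_ : ∀ r ∈ rs, r ∈ IsLocalRing.maximalIdeal A)
    (_ : RingTheory.Sequence.IsRegular M rs), (rs.length : ℕ∞)

/-- A Cohen-Macaulay ring: a Noetherian ring such that `depth A_m = dim A_m` for every
maximal ideal `m`. -/
def IsCohenMacaulayRing (A : Type u) [CommRing A] : Prop :=
  IsNoetherianRing A ∧ ∀ (m : Ideal A) [m.IsMaximal],
    ((localDepth (Localization.AtPrime m) (Localization.AtPrime m) : ℕ∞) : WithBot ℕ∞) =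
      ringKrullDim (Localization.AtPrime m)

/-- A Gorenstein local ring: a Noetherian local ring of finite injective dimension over itself. -/
def IsGorensteinLocalRing (A : Type u) [CommRing A] [IsLocalRing A] : Prop :=
  IsNoetherianRing A ∧
    ∃ n : ℕ, CategoryTheory.HasInjectiveDimensionLE (ModuleCat.of A A) n

/-- A Noetherian ring is generically Gorenstein if its localizations at all associated
prime ideals are Gorenstein. -/
def IsGenericallyGorenstein (A : Type u) [CommRing A] : Prop :=
  IsNoetherianRing A ∧ ∀ (p : Ideal A) [p.IsPrime], p ∈ associatedPrimes A A →
    IsGorensteinLocalRing (Localization.AtPrime p)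

/-- `M ∈ CM(A)`: the module `M` is finitely generated and maximal Cohen-Macaulay, i.e. for every
maximal ideal `m` of `A` either `M_m = 0` or `depth M_m = dim A_m`. -/
def IsMCM (A : Type u) [CommRing A] (M : Type u) [AddCommGroup M] [Module A M] : Prop :=
  Module.Finite A M ∧ ∀ (m : Ideal A) [m.IsMaximal],
    Subsingleton (LocalizedModule m.primeCompl M) ∨
      ((localDepth (Localization.AtPrime m) (LocalizedModule m.primeCompl M) : ℕ∞) :
        WithBot ℕ∞) = ringKrullDim (Localization.AtPrime m)

/-- `M ∈ refl(A)`: the module `M` is finitely generated and the canonical map `M → M**` is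
bijective. -/
def IsRefl (A : Type u) [CommRing A] (M : Type u) [AddCommGroup M] [Module A M] : Prop :=
  Module.Finite A M ∧ Module.IsReflexive A M

/-- `M ∈ ΩCM(A)`: the module `M` is finitely generated and there is an exact sequence
`0 → M → P → N → 0` with `P` finitely generated projective and `N` maximal Cohen-Macaulay. -/
def IsSyzygyOfMCM (A : Type u) [CommRing A] (M : Type u) [AddCommGroup M] [Module A M] : Prop :=
  Module.Finite A M ∧
    ∃ (P : Type u) (_ : AddCommGroup P) (_ : Module A P)
      (N : Type u) (_ : AddCommGroup N) (_ : Module A N) (f : M →ₗ[A] P) (g : P →ₗ[A] N),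
      Module.Finite A P ∧ Module.Projective A P ∧ IsMCM A N ∧
        Function.Injective f ∧ Function.Exact f g ∧ Function.Surjective g

/-- The trace ideal `tr_A(M)`: the sum of the images of all `A`-linear maps `M → A`. -/
def traceIdeal (A : Type u) [CommRing A] (M : Type u) [AddCommGroup M] [Module A M] : Ideal A :=
  ⨆ f : M →ₗ[A] A, LinearMap.range f

/-- The conductor `(R :_Q S) = {a ∈ Q | a S ⊆ R}` of a subalgebra `S` of `Q`; here
`1 : Submodule R Q` is the image of `R` in `Q`. -/
def conductorIn {R Q : Type u} [CommRing R] [CommRing Q] [Algebra R Q] (S : Subalgebra R Q) :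
    Submodule R Q :=
  1 / Subalgebra.toSubmodule S

end BirationalExt

/-! In dimension at most one, maximal Cohen-Macaulay modules are torsion-free, and over `R` finitely
generated torsion-free modules are maximal Cohen-Macaulay. At an associated prime, `R_p` is Artinian
of finite self-injective dimension, hence self-injective. So functionals extend along injections of
finitely generated modules up to a nonzerodivisor, and a submodule of a reflexive `R`-module with
torsion-free quotient is reflexive (`isReflexive_of_isTorsionFree_quotient`).

Reflexive `S`-modules and syzygies of maximal Cohen-Macaulay `S`-modules both embed in a finitely
generated projective `S`-module with torsion-free cokernel. If `S` is reflexive over `R`, that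
projective is too, so the submodule is reflexive over `R`, and hence a syzygy. Conversely `S` itself
lies in both classes. The trace condition is automatic, as functionals `M → R ⊆ Q` are `S`-linear.
-/

namespace BirationalExt

open CategoryTheory Abelian

/-! ### Finite injective dimension over Artinian local rings -/

section InjectiveDimension

variable {A : Type u} [CommRing A]

/-- Vanishing of `Ext` in the first variable passes to extensions. -/
theorem subsingleton_ext_of_submodule (X : ModuleCat.{u} A) (n : ℕ) (M : Type u)
    [AddCommGroup M] [Module A M] (N : Submodule A M)
    (h₁ : Subsingleton (Ext (ModuleCat.of A N) X n))
    (h₃ : Subsingleton (Ext (ModuleCat.of A (M ⧸ N)) X n)) :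
    Subsingleton (Ext (ModuleCat.of A M) X n) := by
  let T : ShortComplex (ModuleCat.{u} A) :=
    ShortComplex.mk (ModuleCat.ofHom N.subtype) (ModuleCat.ofHom N.mkQ)
      (by ext x; simp)
  have hT : T.ShortExact :=
    { exact := (ShortComplex.ShortExact.moduleCat_exact_iff_function_exact _).mpr
        (LinearMap.exact_subtype_mkQ N)
      mono_f := (ModuleCat.mono_iff_injective _).mpr N.injective_subtype
      epi_g := (ModuleCat.epi_iff_surjective _).mpr N.mkQ_surjective }
  refine subsingleton_of_forall_eq 0 fun (e : Ext T.X₂ X n) ↦ ?_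
  obtain ⟨x, rfl⟩ := Ext.contravariant_sequence_exact₂ hT X e (h₁.elim _ _)
  rw [h₃.elim x 0, Ext.comp_zero]

/-- If `Ext^(n + 2)(-, X)` vanishes, then `Ext^(n + 1)(-, X)` vanishes on submodules of
projective modules. -/
theorem subsingleton_ext_of_injective_projective (X : ModuleCat.{u} A) (n : ℕ)
    (hX : ∀ Y : ModuleCat.{u} A, Subsingleton (Ext Y X (n + 2))) (V F : Type u)
    [AddCommGroup V] [Module A V] [AddCommGroup F] [Module A F] [Module.Projective A F]
    (j : V →ₗ[A] F) (hj : Function.Injective j) :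
    Subsingleton (Ext (ModuleCat.of A V) X (n + 1)) := by
  let T : ShortComplex (ModuleCat.{u} A) :=
    ShortComplex.mk (ModuleCat.ofHom j) (ModuleCat.ofHom (LinearMap.range j).mkQ)
      (by ext x; simp)
  have hT : T.ShortExact :=
    { exact := (ShortComplex.ShortExact.moduleCat_exact_iff_function_exact _).mpr
        (LinearMap.exact_map_mkQ_range j)
      mono_f := (ModuleCat.mono_iff_injective _).mpr hj
      epi_g := (ModuleCat.epi_iff_surjective _).mpr (Submodule.mkQ_surjective _) }
  have : Projective T.X₂ := inferInstanceAs (Projective (ModuleCat.of A F))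
  refine subsingleton_of_forall_eq 0 fun (e : Ext T.X₁ X (n + 1)) ↦ ?_
  obtain ⟨x, rfl⟩ := Ext.contravariant_sequence_exact₁ hT X e
    (show 1 + (n + 1) = n + 2 by lia) ((hX _).elim _ _)
  rw [Ext.eq_zero_of_projective x, Ext.comp_zero]

variable [IsLocalRing A] [IsArtinianRing A]

open IsLocalRing

theorem exists_injective_residueField : ∃ j : (A ⧸ maximalIdeal A) →ₗ[A] A,
    Function.Injective j := by
  obtain ⟨p, hp⟩ := associatedPrimes.nonempty A A
  rw [AssociatedPrimes.mem_iff, isAssociatedPrime_iff] at hp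
  obtain ⟨hp, x, hx⟩ := hp
  have hpm : p = maximalIdeal A := eq_maximalIdeal (hp.isMaximal')
  have hker : LinearMap.ker (LinearMap.toSpanSingleton A A x) = maximalIdeal A := by
    rw [← hpm, hx]; ext; simp [Submodule.mem_colon_singleton]
  refine ⟨(maximalIdeal A).liftQ (LinearMap.toSpanSingleton A A x) hker.ge, ?_⟩
  rw [← LinearMap.ker_eq_bot]
  exact Submodule.ker_liftQ_eq_bot _ _ _ hker.le

theorem exists_injective_free_of_isTorsionBySet (V : Type u) [AddCommGroup V] [Module A V]
    (hV : Module.IsTorsionBySet A V (maximalIdeal A : Set A)) :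
    ∃ (ι : Type u) (j : V →ₗ[A] (ι →₀ A)), Function.Injective j := by
  let : Field (A ⧸ maximalIdeal A) := Ideal.Quotient.field _
  let : Module (A ⧸ maximalIdeal A) V := hV.module
  have : IsScalarTower A (A ⧸ maximalIdeal A) V := hV.isScalarTower
  obtain ⟨j, hj⟩ := exists_injective_residueField (A := A)
  let b := Module.Free.chooseBasis (A ⧸ maximalIdeal A) V
  refine ⟨_, (Finsupp.mapRange.linearMap j) ∘ₗ (b.repr.toLinearMap.restrictScalars A), ?_⟩
  exact (Finsupp.mapRange_injective _ (map_zero j) hj).comp b.repr.injective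

/-- Residue-field vector spaces embed in free modules, so one vanishing `Ext` degree shifts down on
them. Every module is a finite iterated extension of such spaces because the maximal ideal is
nilpotent. -/
theorem hasInjectiveDimensionLT_of_succ (X : ModuleCat.{u} A) (n : ℕ)
    [HasInjectiveDimensionLT X (n + 2)] : HasInjectiveDimensionLT X (n + 1) := by
  have hX (Y : ModuleCat.{u} A) : Subsingleton (Ext Y X (n + 2)) :=
    HasInjectiveDimensionLT.subsingleton X (n + 2) (n + 2) le_rfl Y
  have key (k : ℕ) : ∀ (M : Type u) [AddCommGroup M] [Module A M],
      (∀ a ∈ maximalIdeal A ^ k, ∀ x : M, a • x = 0) →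
        Subsingleton (Ext (ModuleCat.of A M) X (n + 1)) := by
    induction k with
    | zero =>
      intro M _ _ hM
      have : Subsingleton M := subsingleton_of_forall_eq 0 fun x ↦ by
        simpa using hM 1 (by simp) x
      exact subsingleton_ext_of_injective_projective X n hX M A 0
        (Function.injective_of_subsingleton _)
    | succ k ih =>
      intro M _ _ hM
      refine subsingleton_ext_of_submodule X (n + 1) M (maximalIdeal A • ⊤) (ih _ ?_) ?_
      · rintro a ha ⟨x, hx⟩
        ext
        change a • x = 0
        refine Submodule.smul_induction_on hx (fun b hb y _ ↦ ?_) (fun y z hy hz ↦ ?_)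
        · rw [smul_smul]
          exact hM _ (by rw [pow_succ]; exact Ideal.mul_mem_mul ha hb) y
        · rw [smul_add, hy, hz, add_zero]
      · obtain ⟨ι, j, hj⟩ := exists_injective_free_of_isTorsionBySet
          (M ⧸ (maximalIdeal A • ⊤ : Submodule A M))
          (Module.isTorsionBySet_quotient_ideal_smul M (maximalIdeal A))
        exact subsingleton_ext_of_injective_projective X n hX _ _ j hj
  obtain ⟨k, hk⟩ := IsArtinianRing.isNilpotent_jacobson_bot (R := A)
  rw [jacobson_eq_maximalIdeal ⊥ bot_ne_top] at hk
  refine hasInjectiveDimensionLT_of_enoughProjectives X (n + 1) fun Y ↦ key k Y ?_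
  intro a ha x
  rw [hk] at ha
  rw [show a = 0 from ha, zero_smul]

/-- A module of finite injective dimension over an Artinian local ring is injective. -/
theorem injective_of_hasInjectiveDimensionLE (M : Type u) [AddCommGroup M] [Module A M] (n : ℕ)
    (h : HasInjectiveDimensionLE (ModuleCat.of A M) n) : Module.Injective A M := by
  induction n with
  | zero =>
    have : Injective (ModuleCat.of A M) := injective_iff_hasInjectiveDimensionLT_one.mpr h
    exact Module.injective_module_of_injective_object A M
  | succ n ih => exact ih (hasInjectiveDimensionLT_of_succ _ n)

end InjectiveDimension

end BirationalExt

namespace BirationalExt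

open nonZeroDivisors IsLocalRing

/-! ### Depth over local rings -/

section Depth

variable {A : Type u} [CommRing A] [IsLocalRing A] {M : Type u} [AddCommGroup M] [Module A M]

theorem exists_isSMulRegular_of_localDepth_ne_zero (h : localDepth A M ≠ 0) :
    ∃ t ∈ maximalIdeal A, IsSMulRegular M t := by
  by_contra! hc
  refine h (le_antisymm ?_ (zero_le))
  refine iSup_le fun rs ↦ iSup_le fun hrs ↦ iSup_le fun hreg ↦ ?_
  cases rs with
  | nil => simp
  | cons t rs =>
    exact absurd ((RingTheory.Sequence.isRegular_cons_iff M t rs).mp hreg).1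
      (hc t (hrs t (by simp)))

theorem one_le_localDepth [Module.Finite A M] [Nontrivial M] {t : A} (ht : t ∈ maximalIdeal A)
    (hreg : IsSMulRegular M t) : 1 ≤ localDepth A M := by
  have hmem : ∀ r ∈ [t], r ∈ maximalIdeal A := by simpa using ht
  have hseq : RingTheory.Sequence.IsRegular M [t] :=
    .of_isWeaklyRegular_of_mem_maximalIdeal M hmem
      ((RingTheory.Sequence.isWeaklyRegular_singleton_iff M t).mpr hreg)
  exact le_iSup_of_le [t] (le_iSup_of_le hmem (le_iSup_of_le hseq (by simp)))

theorem localDepth_le_ringKrullDim [IsNoetherianRing A] [Module.Finite A M] :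
    (localDepth A M : WithBot ℕ∞) ≤ ringKrullDim A := by
  obtain ⟨d, hd⟩ := WithBot.ne_bot_iff_exists.mp (ringKrullDim_ne_bot (R := A))
  rw [← hd, WithBot.coe_le_coe]
  refine iSup_le fun rs ↦ iSup_le fun hrs ↦ iSup_le fun hreg ↦ ?_
  have hlen := Module.supportDim_add_length_eq_supportDim_of_isRegular rs hreg
  have hnt := hreg.quot_ofList_smul_nontrivial ⊤
  obtain ⟨e, he⟩ := WithBot.ne_bot_iff_exists.mp
    (Module.supportDim_ne_bot_of_nontrivial A
      (M ⧸ Ideal.ofList rs • (⊤ : Submodule A M)))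
  have hle := Module.supportDim_le_ringKrullDim A M
  rw [← hlen, ← he, ← hd] at hle
  have hle' : e + (rs.length : ℕ∞) ≤ d := by exact_mod_cast hle
  exact le_trans (le_add_left le_rfl) hle'

end Depth

/-! ### Associated primes and prime avoidance -/

section AssociatedPrimes

variable {R : Type u} [CommRing R]

theorem ringKrullDim_localization_atPrime_le (p : Ideal R) [p.IsPrime] :
    ringKrullDim (Localization.AtPrime p) ≤ ringKrullDim R := by
  rw [IsLocalization.AtPrime.ringKrullDim_eq_height p]
  exact Ideal.height_le_ringKrullDim_of_isPrime

/-- All of the maximal ideal of `R_m` consists of zero divisors, so the depth, and with it the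
dimension, is zero. -/
theorem ringKrullDim_localization_eq_zero_of_mem_associatedPrimes
    (hCM : IsCohenMacaulayRing R) (m : Ideal R) [m.IsMaximal] (hm : m ∈ associatedPrimes R R) :
    ringKrullDim (Localization.AtPrime m) = 0 := by
  have : IsNoetherianRing R := hCM.1
  rw [← hCM.2 m, WithBot.coe_eq_zero]
  by_contra hne
  obtain ⟨t, ht, hreg⟩ := exists_isSMulRegular_of_localDepth_ne_zero hne
  have hass := Module.associatedPrimes.mem_associatedPrimes_atPrime_of_mem_associatedPrimes hm
  have hmem : t ∈ ⋃ p ∈ associatedPrimes (Localization.AtPrime m) (LocalizedModule.AtPrime m R),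
      (p : Set (Localization.AtPrime m)) := Set.mem_iUnion₂_of_mem hass ht
  rw [biUnion_associatedPrimes_eq_compl_regular] at hmem
  exact hmem hreg

theorem isArtinianRing_localization_of_mem_associatedPrimes (hCM : IsCohenMacaulayRing R)
    (hdim : ringKrullDim R ≤ 1) (p : Ideal R) [p.IsPrime] (hp : p ∈ associatedPrimes R R) :
    IsArtinianRing (Localization.AtPrime p) := by
  have : IsNoetherianRing R := hCM.1
  have : IsNoetherianRing (Localization.AtPrime p) :=
    IsLocalization.isNoetherianRing p.primeCompl _ inferInstance
  have : Ring.KrullDimLE 0 (Localization.AtPrime p) := by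
    rw [Ring.krullDimLE_iff]
    by_cases hmax : p.IsMaximal
    · exact (ringKrullDim_localization_eq_zero_of_mem_associatedPrimes hCM p hp).le
    · obtain ⟨m, hm, hle⟩ := p.exists_le_maximal (Ideal.IsPrime.ne_top ‹_›)
      have hlt : p < m := lt_of_le_of_ne hle fun h ↦ hmax (h ▸ hm)
      have h1 : p.height + 1 ≤ m.height := Ideal.height_add_one_le_of_lt_of_isPrime hlt
      have h2 : m.height ≤ 1 := by
        have := (ringKrullDim_le_iff_height_le 1).mp hdim hm.isPrime
        exact_mod_cast this
      have h3 : p.height ≤ 0 := by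
        have h4 : p.height + 1 ≤ 0 + 1 := by simpa using h1.trans h2
        exact (ENat.add_le_add_iff_right (by simp)).mp h4
      rw [IsLocalization.AtPrime.ringKrullDim_eq_height p]
      exact_mod_cast h3
  exact isArtinianRing_iff_isNoetherianRing_krullDimLE_zero.mpr ⟨inferInstance, this⟩

/-- An ideal of a Noetherian ring contained in no associated prime contains a regular element. -/
theorem exists_mem_nonZeroDivisors_of_forall_not_le [IsNoetherianRing R] (I : Ideal R)
    (h : ∀ p ∈ associatedPrimes R R, ¬ I ≤ p) : ∃ t ∈ I, t ∈ R⁰ := by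
  by_contra! hc
  have hsub : (I : Set R) ⊆ ⋃ p ∈ associatedPrimes R R, (p : Set R) := by
    rw [biUnion_associatedPrimes_eq_compl_nonZeroDivisors]
    exact fun t ht ↦ hc t ht
  have hfin := associatedPrimes.finite R R
  obtain ⟨p, hp, hle⟩ := (Ideal.subset_union_prime_finite hfin (f := id) ⊥ ⊥
    (fun p hp _ _ ↦ hp.isPrime)).mp hsub
  exact h p hp hle

end AssociatedPrimes

/-! ### Maximal Cohen-Macaulay versus torsion-free modules -/

section MaximalCohenMacaulay

variable {R : Type u} [CommRing R]

theorem isMCM_of_isTorsionFree (hCM : IsCohenMacaulayRing R) (hdim : ringKrullDim R ≤ 1)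
    (N : Type u) [AddCommGroup N] [Module R N] [Module.Finite R N] [Module.IsTorsionFree R N] :
    IsMCM R N := by
  have : IsNoetherianRing R := hCM.1
  refine ⟨inferInstance, fun m hm ↦ ?_⟩
  refine or_iff_not_imp_left.mpr fun hN ↦ ?_
  rw [not_subsingleton_iff_nontrivial] at hN
  have : IsNoetherianRing (Localization.AtPrime m) :=
    IsLocalization.isNoetherianRing m.primeCompl _ inferInstance
  refine le_antisymm localDepth_le_ringKrullDim ?_
  -- Either the dimension at `m` is zero, or prime avoidance puts a nonzerodivisor of `R` in `m`,
  -- which forces depth at least one.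
  by_cases hass : m ∈ associatedPrimes R R
  · rw [ringKrullDim_localization_eq_zero_of_mem_associatedPrimes hCM m hass]
    exact_mod_cast zero_le
  · obtain ⟨s, hsm, hs⟩ := exists_mem_nonZeroDivisors_of_forall_not_le m fun p hp hle ↦
      hass (hm.eq_of_le hp.isPrime.ne_top hle ▸ hp)
    have hreg : IsSMulRegular N s :=
      (isRegular_iff_mem_nonZeroDivisors.mpr hs).isSMulRegular
    have hreg' : IsSMulRegular (LocalizedModule m.primeCompl N)
        (algebraMap R (Localization.AtPrime m) s) := by
      have := hreg.of_isLocalizedModule (Localization.AtPrime m) m.primeCompl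
        (LocalizedModule.mkLinearMap m.primeCompl N)
      exact this
    have hle : ringKrullDim (Localization.AtPrime m) ≤ 1 :=
      (ringKrullDim_localization_atPrime_le m).trans hdim
    refine hle.trans ?_
    have := one_le_localDepth (M := LocalizedModule m.primeCompl N)
      ((IsLocalization.AtPrime.to_map_mem_maximal_iff _ m s).mpr hsm) hreg'
    exact_mod_cast this

/-- The base ring need not be Cohen-Macaulay, so this applies directly to `S`. -/
theorem isTorsionFree_of_isMCM [IsNoetherianRing R] (hdim : ringKrullDim R ≤ 1)
    (N : Type u) [AddCommGroup N] [Module R N] (hN : IsMCM R N) : Module.IsTorsionFree R N where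
  isSMulRegular s hs := by
    rw [isSMulRegular_iff_right_eq_zero_of_smul]
    intro x hx
    refine Module.eq_zero_of_localization_maximal (fun (m : Ideal R) _ ↦ LocalizedModule m.primeCompl N)
      (fun (m : Ideal R) _ ↦ LocalizedModule.mkLinearMap m.primeCompl N) x fun m hm ↦ ?_
    rcases hN.2 m with hsub | hdep
    · exact Subsingleton.elim _ _
    have : IsNoetherianRing (Localization.AtPrime m) :=
      IsLocalization.isNoetherianRing m.primeCompl _ inferInstance
    set s' := algebraMap R (Localization.AtPrime m) s with hs'
    set x' := LocalizedModule.mkLinearMap m.primeCompl N x with hx'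
    have hsx : s' • x' = 0 := by
      rw [hs', algebraMap_smul, hx', ← map_smul, hx, map_zero]
    by_cases hsm : s ∈ m
    · have hmem : s' ∈ maximalIdeal (Localization.AtPrime m) :=
        (IsLocalization.AtPrime.to_map_mem_maximal_iff _ m s).mpr hsm
      have hreg : s' ∈ (Localization.AtPrime m)⁰ :=
        IsLocalization.map_nonZeroDivisors_le m.primeCompl _
          (Submonoid.mem_map_of_mem _ (isRegular_iff_mem_nonZeroDivisors.mp hs))
      have hle : ringKrullDim (Localization.AtPrime m) ≤ 1 :=
        (ringKrullDim_localization_atPrime_le m).trans hdim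
      have hquot :=
        ringKrullDim_quotient_span_singleton_succ_eq_ringKrullDim_of_mem_nonZeroDivisors hreg hmem
      have hnt : Nontrivial (Localization.AtPrime m ⧸ Ideal.span {s'}) :=
        Ideal.Quotient.nontrivial_iff.mpr (ne_top_of_le_ne_top
          (maximalIdeal.isMaximal _).ne_top ((Ideal.span_singleton_le_iff_mem _).mpr hmem))
      obtain ⟨d, hd⟩ := WithBot.ne_bot_iff_exists.mp
        ((WithBot.bot_lt_coe 0).trans_le (ringKrullDim_nonneg_of_nontrivial
          (R := Localization.AtPrime m ⧸ Ideal.span {s'}))).ne'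
      have hd0 : d = 0 := by
        rw [← hquot, ← hd] at hle
        have h4 : d + 1 ≤ 0 + 1 := by simpa using (by exact_mod_cast hle : d + 1 ≤ 1)
        simpa using (ENat.add_le_add_iff_right (by simp)).mp h4
      have hkd : Ring.KrullDimLE 0 (Localization.AtPrime m ⧸ Ideal.span {s'}) := by
        rw [Ring.krullDimLE_iff, ← hd, hd0]; rfl
      have hdep0 : localDepth (Localization.AtPrime m) (LocalizedModule m.primeCompl N) ≠ 0 := by
        intro h0
        rw [h0, ← hquot, ← hd, hd0] at hdep
        exact absurd hdep (by norm_num)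
      obtain ⟨t, ht, htreg⟩ := exists_isSMulRegular_of_localDepth_ne_zero hdep0
      -- Modulo `s'` the dimension is zero, so a power of the module-regular element `t` is a
      -- multiple of `s'` and kills `x'`.
      have hrad : t ∈ (Ideal.span {s'}).radical := by
        rw [← Ideal.sInf_minimalPrimes, Ideal.mem_sInf]
        intro P hP
        rwa [eq_maximalIdeal
          (Ideal.krullDimLE_zero_quotient_iff_forall_minimalPrimes_isMaximal.mp hkd P hP)]
      obtain ⟨k, hk⟩ := hrad
      obtain ⟨c, hc⟩ := Ideal.mem_span_singleton'.mp hk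
      refine (htreg.pow k) ?_
      change t ^ k • x' = t ^ k • 0
      rw [smul_zero, ← hc, mul_smul, hsx, smul_zero]
    · have hu : IsUnit s' := IsLocalization.map_units (M := m.primeCompl) _ ⟨s, hsm⟩
      exact (hu.smul_eq_zero).mp hsx

theorem ringKrullDim_le_of_isIntegral (S : Type u) [CommRing S] [Algebra R S]
    [Algebra.IsIntegral R S] : ringKrullDim S ≤ ringKrullDim R :=
  Order.krullDim_le_of_strictMono (PrimeSpectrum.comap (algebraMap R S)) fun p q hpq ↦
    Ideal.IsIntegral.comap_lt_comap (I := p.asIdeal) (J := q.asIdeal) hpq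

end MaximalCohenMacaulay

end BirationalExt

namespace BirationalExt

open nonZeroDivisors Module

/-! ### Extending functionals up to a nonzerodivisor -/

section GenericExtension

variable {R : Type u} [CommRing R] {M P : Type u} [AddCommGroup M] [Module R M]
  [AddCommGroup P] [Module R P]

/-- If `R_p` is self-injective, then up to a multiplier outside `p` a functional extends along
an injection of finitely generated modules. -/
theorem exists_smul_extension_of_injective_localization [IsNoetherianRing R] [Module.Finite R M]
    [Module.Finite R P] (f : M →ₗ[R] P) (hf : Function.Injective f) (φ : Dual R M)
    (p : Ideal R) [p.IsPrime]
    [Module.Injective (Localization.AtPrime p) (Localization.AtPrime p)] :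
    ∃ t ∉ p, ∃ g : Dual R P, g ∘ₗ f = t • φ := by
  let lin := Algebra.linearMap R (Localization.AtPrime p)
  obtain ⟨h, hh⟩ := Module.Injective.extension_property (Localization.AtPrime p)
    (Localization.AtPrime p) _ _ (LocalizedModule.map p.primeCompl f)
    (LocalizedModule.map_injective p.primeCompl f hf)
    (IsLocalizedModule.mapExtendScalars p.primeCompl (LocalizedModule.mkLinearMap p.primeCompl M)
      lin (Localization.AtPrime p) φ)
  let g₀ : P →ₗ[R] Localization.AtPrime p :=
    h.restrictScalars R ∘ₗ LocalizedModule.mkLinearMap p.primeCompl P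
  have hg₀ (x : M) : g₀ (f x) = lin (φ x) := by
    have := LinearMap.congr_fun hh (LocalizedModule.mkLinearMap p.primeCompl M x)
    rw [← IsLocalizedModule.map_apply p.primeCompl
      (LocalizedModule.mkLinearMap p.primeCompl M) lin φ x]
    simpa [g₀, LocalizedModule.map_mk] using this
  have : FinitePresentation R P := finitePresentation_of_finite R P
  obtain ⟨g₁, s, hs⟩ := FinitePresentation.exists_lift_of_isLocalizedModule p.primeCompl lin g₀
  have hcomp : lin ∘ₗ (g₁ ∘ₗ f) = lin ∘ₗ (s.1 • φ) := by
    ext x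
    have := LinearMap.congr_fun hs (f x)
    simp only [LinearMap.comp_apply, LinearMap.smul_apply, hg₀, map_smul] at this ⊢
    exact this
  obtain ⟨u, hu⟩ := Module.Finite.exists_smul_of_comp_eq_of_isLocalizedModule p.primeCompl lin
    (g₁ ∘ₗ f) (s.1 • φ) hcomp
  refine ⟨u.1 * s.1, (u * s).2, u.1 • g₁, ?_⟩
  rw [LinearMap.smul_comp, mul_smul]
  exact hu

theorem exists_nonZeroDivisor_smul_extension [IsNoetherianRing R] [Module.Finite R M]
    [Module.Finite R P]
    (hR : ∀ (p : Ideal R) [p.IsPrime], p ∈ associatedPrimes R R →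
      Module.Injective (Localization.AtPrime p) (Localization.AtPrime p))
    (f : M →ₗ[R] P) (hf : Function.Injective f) (φ : Dual R M) :
    ∃ t ∈ R⁰, ∃ g : Dual R P, g ∘ₗ f = t • φ := by
  -- The ideal of multipliers making `φ` extendable; no associated prime contains it.
  let J : Ideal R := (LinearMap.range f.dualMap).comap (LinearMap.toSpanSingleton R (Dual R M) φ)
  have hJ (t : R) : t ∈ J ↔ ∃ g : Dual R P, g ∘ₗ f = t • φ := Iff.rfl
  obtain ⟨t, htJ, ht⟩ := exists_mem_nonZeroDivisors_of_forall_not_le J fun p hp hle ↦ by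
    have := hp.isPrime
    have := hR p hp
    obtain ⟨t, htp, hg⟩ := exists_smul_extension_of_injective_localization f hf φ p
    exact htp (hle ((hJ t).mpr hg))
  exact ⟨t, ht, (hJ t).mp htJ⟩

/-- A finitely generated torsion-free module over a generically self-injective ring is
torsionless. -/
theorem exists_dual_ne_zero_of_isTorsionFree [IsNoetherianRing R] [Module.Finite R P]
    [IsTorsionFree R P]
    (hR : ∀ (p : Ideal R) [p.IsPrime], p ∈ associatedPrimes R R →
      Module.Injective (Localization.AtPrime p) (Localization.AtPrime p))
    {x : P} (hx : x ≠ 0) : ∃ g : Dual R P, g x ≠ 0 := by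
  let f := LinearMap.toSpanSingleton R P x
  obtain ⟨p, hp, hle⟩ : ∃ p ∈ associatedPrimes R R, LinearMap.ker f ≤ p := by
    by_contra! hc
    obtain ⟨t, htI, ht⟩ := exists_mem_nonZeroDivisors_of_forall_not_le _ hc
    exact hx ((isRegular_iff_mem_nonZeroDivisors.mpr ht).isSMulRegular.right_eq_zero_of_smul htI)
  rw [AssociatedPrimes.mem_iff, isAssociatedPrime_iff] at hp
  obtain ⟨hpp, r, hpr⟩ := hp
  have hr : r ≠ 0 := by
    rintro rfl
    exact hpp.ne_top (hpr.trans (by simp))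
  -- Since `p` is the annihilator of `r`, sending `x` to `r` is a well-defined nonzero functional on
  -- `Rx`; a regular multiple of it extends to `P`.
  have hker : LinearMap.ker f ≤ LinearMap.ker (LinearMap.toSpanSingleton R R r) := fun a ha ↦ by
    have := hle ha
    rw [hpr, Submodule.mem_colon_singleton] at this
    simpa using this
  obtain ⟨t, ht, g, hg⟩ := exists_nonZeroDivisor_smul_extension hR
    ((LinearMap.ker f).liftQ f le_rfl)
    (LinearMap.ker_eq_bot.mp (Submodule.ker_liftQ_eq_bot _ _ _ le_rfl))
    ((LinearMap.ker f).liftQ (LinearMap.toSpanSingleton R R r) hker)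
  refine ⟨g, fun h0 ↦ hr ?_⟩
  have h1 := LinearMap.congr_fun hg (Submodule.Quotient.mk 1)
  simp only [LinearMap.comp_apply, Submodule.liftQ_apply, LinearMap.smul_apply] at h1
  have h2 : t * r = 0 := by simpa [f, h0] using h1.symm
  exact (mul_left_mem_nonZeroDivisors_eq_zero_iff ht).mp h2

/-- Over a generically self-injective ring, a submodule of a reflexive module with torsion-free
quotient is reflexive. -/
theorem isReflexive_of_isTorsionFree_quotient [IsNoetherianRing R]
    [Module.Finite R P] [IsReflexive R P]
    (hR : ∀ (p : Ideal R) [p.IsPrime], p ∈ associatedPrimes R R →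
      Module.Injective (Localization.AtPrime p) (Localization.AtPrime p))
    (f : M →ₗ[R] P) (hf : Function.Injective f) [IsTorsionFree R (P ⧸ LinearMap.range f)] :
    IsReflexive R M := by
  have : Module.Finite R M := Module.Finite.of_injective f hf
  refine ⟨fun x y hxy ↦ hf ((bijective_dual_eval R P).1 ?_), fun α ↦ ?_⟩
  · ext g
    exact LinearMap.congr_fun hxy (g ∘ₗ f)
  · obtain ⟨q, hq⟩ := (bijective_dual_eval R P).2 (f.dualMap.dualMap α)
    have hq' (g : Dual R P) : α (g ∘ₗ f) = g q := (LinearMap.congr_fun hq g).symm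
    -- By `hq'`, every functional vanishing on the range of `f` kills `q`, while the torsion-free
    -- quotient is torsionless.
    have hmem : q ∈ LinearMap.range f := by
      by_contra hq0
      obtain ⟨g, hg⟩ := exists_dual_ne_zero_of_isTorsionFree hR
        (x := (LinearMap.range f).mkQ q) (by simpa using hq0)
      refine hg ((hq' (g ∘ₗ (LinearMap.range f).mkQ)).symm.trans ?_)
      rw [LinearMap.comp_assoc, LinearMap.range_mkQ_comp, LinearMap.comp_zero, map_zero]
    obtain ⟨x, rfl⟩ := hmem
    refine ⟨x, LinearMap.ext fun φ ↦ ?_⟩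
    -- Then `t * α φ = g (f x) = t * φ x`, and `t` cancels.
    obtain ⟨t, ht, g, hg⟩ := exists_nonZeroDivisor_smul_extension hR f hf φ
    have h := hq' g
    rw [← LinearMap.comp_apply, hg, map_smul, LinearMap.smul_apply] at h
    exact ((isRegular_iff_mem_nonZeroDivisors.mpr ht).left h).symm

end GenericExtension

/-! ### Reflexive modules and syzygies -/

section Syzygy

variable {A : Type u} [CommRing A] [IsNoetherianRing A]

/-- A finitely generated reflexive module embeds into a finitely generated projective module
with torsion-free cokernel. -/
theorem exists_injective_isTorsionFree_quotient (M : Type u) [AddCommGroup M] [Module A M]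
    [Module.Finite A M] [IsReflexive A M] :
    ∃ (n : ℕ) (f : M →ₗ[A] Dual A (Fin n → A)), Function.Injective f ∧
      IsTorsionFree A (Dual A (Fin n → A) ⧸ LinearMap.range f) := by
  obtain ⟨n, π, hπ⟩ := Module.Finite.exists_fin' A (Dual A M)
  refine ⟨n, π.dualMap ∘ₗ Dual.eval A M,
    (LinearMap.dualMap_injective_of_surjective hπ).comp (bijective_dual_eval A M).1, ⟨?_⟩⟩
  intro t ht
  rw [isSMulRegular_quotient_iff_mem_of_smul_mem]
  rintro ψ ⟨x, hx⟩
  -- As `t • ψ` factors through `π` and `t` is regular, `ψ` also factors through `π`; by reflexivity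
  -- the resulting functional on `Dual A M` is an evaluation.
  have hker : LinearMap.ker π ≤ LinearMap.ker ψ := fun y hy ↦ by
    have h := LinearMap.congr_fun hx y
    have h0 : t * ψ y = 0 := by
      rw [← smul_eq_mul, ← LinearMap.smul_apply, ← h]
      simp [LinearMap.mem_ker.mp hy]
    exact ht.left.mul_left_eq_zero_iff.mp h0
  obtain ⟨β, hβ⟩ : ψ ∈ LinearMap.range π.dualMap := by
    rw [LinearMap.range_dualMap_eq_dualAnnihilator_ker_of_surjective π hπ,
      Submodule.mem_dualAnnihilator]
    exact fun y hy ↦ hker hy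
  obtain ⟨y, rfl⟩ := (bijective_dual_eval A M).2 β
  exact ⟨y, hβ⟩

theorem isSyzygyOfMCM_of_isRefl (hCM : IsCohenMacaulayRing A) (hdim : ringKrullDim A ≤ 1)
    {M : Type u} [AddCommGroup M] [Module A M] (hM : IsRefl A M) : IsSyzygyOfMCM A M := by
  have := hM.1
  have := hM.2
  obtain ⟨n, f, hf, htf⟩ := exists_injective_isTorsionFree_quotient (A := A) M
  exact ⟨hM.1, _, _, _, _, _, _, f, (LinearMap.range f).mkQ, inferInstance, inferInstance,
    isMCM_of_isTorsionFree hCM hdim _, hf, LinearMap.exact_map_mkQ_range f,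
    Submodule.mkQ_surjective _⟩

theorem IsSyzygyOfMCM.exists_injective (hdim : ringKrullDim A ≤ 1)
    {M : Type u} [AddCommGroup M] [Module A M] (hM : IsSyzygyOfMCM A M) :
    ∃ (P : Type u) (_ : AddCommGroup P) (_ : Module A P) (f : M →ₗ[A] P),
      Module.Finite A P ∧ Module.Projective A P ∧ Function.Injective f ∧
        IsTorsionFree A (P ⧸ LinearMap.range f) := by
  obtain ⟨-, P, _, _, N, _, _, f, g, hfin, hproj, hN, hf, hfg, hg⟩ := hM
  have := isTorsionFree_of_isMCM hdim N hN
  refine ⟨P, _, _, f, hfin, hproj, hf, ⟨fun t ht ↦ ?_⟩⟩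
  rw [isSMulRegular_quotient_iff_mem_of_smul_mem]
  intro x hx
  rw [LinearMap.mem_range] at hx ⊢
  rw [← Set.mem_range, ← hfg] at hx ⊢
  rw [map_smul] at hx
  exact ht.isSMulRegular.right_eq_zero_of_smul hx

end Syzygy

end BirationalExt

namespace BirationalExt

open nonZeroDivisors Module

/-! ### Descent from `S` to `R`, and the trace ideal -/

section BirationalExtension

theorem injective_localization_of_isGenericallyGorenstein {R : Type u} [CommRing R]
    (hCM : IsCohenMacaulayRing R) (hdim : ringKrullDim R ≤ 1) (hG : IsGenericallyGorenstein R)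
    (p : Ideal R) [p.IsPrime] (hp : p ∈ associatedPrimes R R) :
    Module.Injective (Localization.AtPrime p) (Localization.AtPrime p) := by
  have := isArtinianRing_localization_of_mem_associatedPrimes hCM hdim p hp
  obtain ⟨-, n, hn⟩ := hG.2 p hp
  exact injective_of_hasInjectiveDimensionLE _ n hn

/-- Reflexivity of `S` over `R` passes to finitely generated projective `S`-modules. -/
theorem isReflexive_of_projective (R S P : Type u) [CommRing R] [CommRing S] [Algebra R S]
    [IsReflexive R S] [AddCommGroup P] [Module S P] [Module R P] [IsScalarTower R S P]
    [Module.Finite S P] [Module.Projective S P] : IsReflexive R P := by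
  obtain ⟨n, f, g, -, -, hfg⟩ := Module.Finite.exists_comp_eq_id_of_projective S P
  have : IsReflexive R (Fin n → S) := by
    clear hfg f g
    induction n with
    | zero => infer_instance
    | succ n ih => exact Module.equiv (Fin.consLinearEquiv R fun _ : Fin (n + 1) ↦ S)
  exact .of_split (g.restrictScalars R) (f.restrictScalars R)
    (LinearMap.ext fun x ↦ LinearMap.congr_fun hfg x)

variable {R : Type u} [CommRing R]

/-- Let `S` be a finite `R`-algebra which is reflexive over `R`. An `S`-submodule
of a finitely generated projective `S`-module with torsion-free quotient is reflexive over `R`. -/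
theorem isReflexive_of_isTorsionFree_quotient_projective [IsNoetherianRing R]
    (hR : ∀ (p : Ideal R) [p.IsPrime], p ∈ associatedPrimes R R →
      Module.Injective (Localization.AtPrime p) (Localization.AtPrime p))
    {S M P : Type u} [CommRing S] [Algebra R S] [Module.Finite R S] [IsReflexive R S]
    [AddCommGroup M] [Module S M] [Module R M] [IsScalarTower R S M]
    [AddCommGroup P] [Module S P] [Module.Finite S P] [Module.Projective S P]
    (f : M →ₗ[S] P) (hf : Function.Injective f) [IsTorsionFree S (P ⧸ LinearMap.range f)] :
    IsReflexive R M := by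
  let : Module R P := Module.compHom P (algebraMap R S)
  have : IsScalarTower R S P := ⟨fun r s x ↦ by
    rw [Algebra.smul_def, mul_smul]; rfl⟩
  have : Module.Finite R P := Module.Finite.trans S P
  have : IsReflexive R P := isReflexive_of_projective R S P
  have : IsTorsionFree R (P ⧸ LinearMap.range f) := .trans S
  have : IsTorsionFree R (P ⧸ LinearMap.range (f.restrictScalars R)) := this
  exact isReflexive_of_isTorsionFree_quotient hR (f.restrictScalars R) hf

variable {Q : Type u} [CommRing Q] [Algebra R Q] [IsFractionRing R Q]

/-- An `R`-linear functional on an `S`-module, viewed in the total ring of fractions, is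
`S`-linear. -/
theorem algebraMap_dual_smul (S : Subalgebra R Q) {M : Type u} [AddCommGroup M] [Module S M]
    [Module R M] [IsScalarTower R S M] (g : Dual R M) (s : S) (x : M) :
    algebraMap R Q (g (s • x)) = s * algebraMap R Q (g x) := by
  -- Writing `s = r / t` reduces `S`-linearity to `R`-linearity after multiplying by `t`, a unit in
  -- `Q`.
  obtain ⟨⟨r, t⟩, hrt⟩ := IsLocalization.surj R⁰ (s : Q)
  have hts : t.1 • s = algebraMap R S r := by
    ext
    rw [Subalgebra.coe_smul, Algebra.smul_def, mul_comm]
    exact hrt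
  have h : t.1 * g (s • x) = r * g x := by
    rw [← smul_eq_mul, ← map_smul, ← smul_assoc, hts, algebraMap_smul, map_smul, smul_eq_mul]
  refine (IsLocalization.map_units Q t).mul_left_cancel ?_
  rw [← map_mul, h, map_mul, ← mul_assoc, mul_comm _ (s : Q), hrt]

theorem map_traceIdeal_le_conductorIn (S : Subalgebra R Q) (M : Type u) [AddCommGroup M]
    [Module S M] [Module R M] [IsScalarTower R S M] :
    Submodule.map (Algebra.linearMap R Q) (traceIdeal R M) ≤ conductorIn S := by
  rw [traceIdeal, Submodule.map_iSup, iSup_le_iff]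
  rintro g _ ⟨_, ⟨x, rfl⟩, rfl⟩
  rw [conductorIn, Submodule.mem_div_iff_forall_mul_mem]
  intro s hs
  rw [Submodule.mem_one]
  exact ⟨g ((⟨s, hs⟩ : S) • x), by
    rw [algebraMap_dual_smul, mul_comm]; rfl⟩

end BirationalExtension

end BirationalExt

theorem proposition2p6 {R Q : Type u} [CommRing R] [CommRing Q] [Algebra R Q]
    [IsFractionRing R Q]
    (hCM : BirationalExt.IsCohenMacaulayRing R) (hdim : ringKrullDim R = 1)
    (hG : BirationalExt.IsGenericallyGorenstein R)
    (S : Subalgebra R Q) (hS : Module.Finite R S) :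
    List.TFAE [
      BirationalExt.IsRefl R S,
      ∀ (M : Type u) [AddCommGroup M] [Module S M] [Module R M] [IsScalarTower R S M],
        BirationalExt.IsSyzygyOfMCM S M → BirationalExt.IsSyzygyOfMCM R M,
      ∀ (M : Type u) [AddCommGroup M] [Module S M] [Module R M] [IsScalarTower R S M],
        BirationalExt.IsRefl S M → BirationalExt.IsRefl R M,
      ∀ (M : Type u) [AddCommGroup M] [Module S M] [Module R M] [IsScalarTower R S M],
        BirationalExt.IsRefl S M →
          BirationalExt.IsRefl R M ∧
            Submodule.map (Algebra.linearMap R Q) (BirationalExt.traceIdeal R M) ≤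
              BirationalExt.conductorIn S] := by
  have : IsNoetherianRing R := hCM.1
  have : IsNoetherianRing S := IsNoetherianRing.of_finite R S
  have hdimS : ringKrullDim S ≤ 1 :=
    (BirationalExt.ringKrullDim_le_of_isIntegral S).trans hdim.le
  have hR (p : Ideal R) [p.IsPrime] (hp : p ∈ associatedPrimes R R) :
      Module.Injective (Localization.AtPrime p) (Localization.AtPrime p) :=
    BirationalExt.injective_localization_of_isGenericallyGorenstein hCM hdim.le hG p hp
  tfae_have 1 → 2 := by
    intro ⟨_, _⟩ M _ _ _ _ hM
    obtain ⟨P, _, _, f, _, _, hf, _⟩ := hM.exists_injective hdimS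
    have := hM.1
    exact BirationalExt.isSyzygyOfMCM_of_isRefl hCM hdim.le ⟨Module.Finite.trans S M,
      BirationalExt.isReflexive_of_isTorsionFree_quotient_projective hR f hf⟩
  tfae_have 2 → 1 := by
    intro h
    -- The cokernel is the zero module, which counts as maximal Cohen-Macaulay.
    have hSS : BirationalExt.IsSyzygyOfMCM S S :=
      ⟨inferInstance, S, _, _, PUnit, _, _, LinearMap.id, 0, inferInstance, inferInstance,
        ⟨inferInstance, fun m _ ↦ .inl inferInstance⟩, Function.injective_id,
        fun x ↦ by simp, fun x ↦ ⟨0, rfl⟩⟩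
    obtain ⟨P, _, _, f, _, _, hf, _⟩ := (h S hSS).exists_injective hdim.le
    exact ⟨hS, BirationalExt.isReflexive_of_isTorsionFree_quotient hR f hf⟩
  tfae_have 1 → 3 := by
    intro ⟨_, _⟩ M _ _ _ _ ⟨_, _⟩
    obtain ⟨n, f, hf, _⟩ := BirationalExt.exists_injective_isTorsionFree_quotient (A := S) M
    exact ⟨Module.Finite.trans S M,
      BirationalExt.isReflexive_of_isTorsionFree_quotient_projective hR f hf⟩
  tfae_have 3 → 1 := fun h ↦ h S ⟨inferInstance, inferInstance⟩
  tfae_have 3 → 4 := fun h M _ _ _ _ hM ↦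
    ⟨h M hM, BirationalExt.map_traceIdeal_le_conductorIn S M⟩
  tfae_have 4 → 3 := fun h M _ _ _ _ hM ↦ (h M hM).1
  tfae_finish
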